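/- Let $k$ be a field with duality $D=\mathrm{Hom}_k(-,k)$, and let $\mathcal{A}$ be a skeletally small, Hom-finite, $k$-linear abelian category. A *Serre duality* on such a category consists of a $k$-linear auto-equivalence $\mathbb{S}$ (the *Serre functor*) and $k$-linear isomorphisms $\phi_{X,Y}\colon D\,\mathrm{Ext}^1(X,Y)\to \mathrm{Hom}(Y,\mathbb{S}X)$, natural in $X$ and $Y$. Its trace maps are $\mathrm{Tr}_X=\phi_{X,\mathbb{S}X}^{-1}(\mathrm{Id}_{\mathbb{S}X})\colon \mathrm{Ext}^1(X,\mathbb{S}X)\to k$. It is *perfect* if the commutator isomorphism of $\mathbb{S}$ is the identity of $\mathbb{S}^2$, that is, if $\mathrm{Tr}_X([\xi])=\mathrm{Tr}_{\mathbb{S}X}([\mathbb{S}(\xi)])$ for all objects $X$ and all $[\xi]\in \mathrm{Ext}^1(X,\mathbb{S}X)$. For an auto-equivalence $F$, its *order* is the least $d\ge 1$ with $F^d\cong \mathrm{Id}$, if such a $d$ exists. A natural isomorphism $\theta\colon F^d\to\mathrm{Id}$ is *compatible* if $\theta F=F\theta$. A $k$-linear auto-equivalence $F$ and a compatible $\theta\colon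 F^d\to\mathrm{Id}$ induce a $k$-linear action of the cyclic group $C_d=\{e,g,\dots,g^{d-1}\}$: put $F_{g^i}=F^i$ for $0\le i\le d-1$, and let $\varepsilon_{g^i,g^j}\colon F_{g^i}F_{g^j}\to F_{g^ig^j}$ be the identity if $i+j\le d-1$ and $F^{i+j-d}\theta$ otherwise. The equivariantization $\mathcal{A}^{C_d}$ is the $k$-linear abelian category of pairs $(X,\alpha)$ with isomorphisms $\alpha_h\colon X\to F_hX$ $(h\in C_d)$ such that $\alpha_{hh'}=(\varepsilon_{h,h'})_X\circ F_h(\alpha_{h'})\circ\alpha_h$; a morphism $(X,\alpha)\to(Y,\beta)$ is a morphism $f\colon X\to Y$ with $\beta_h\circ f=F_h(f)\circ\alpha_h$ for all $h$. **Corollary 3.8.** Suppose that $\mathcal{A}$ has a perfect Serre duality whose Serre functor $\mathbb{S}$ has finite order $d$, and that $d$ is invertible in $k$. Then every natural isomorphism $\eta\colon\mathbb{S}^d\to\mathrm{Id}_{\mathcal{A}}$ is compatible, and for every such $\eta$ the equivariantization $\mathcal{A}/\!\!/\mathbb{S}=\mathcal{A}^{C_d}$ with respect to the $C_d$-action induced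 by $\mathbb{S}$ and $\eta$ has a Serre duality, and the Serre functor of any Serre duality on $\mathcal{A}/\!\!/\mathbb{S}$ is isomorphic to the identity functor. -/

import Mathlib

open CategoryTheory CategoryTheory.Limits CategoryTheory.Abelian

universe w v u

-- Every abelian category `C : Type u` with `Category.{v} C` has Ext groups in `Type (max u v)`.
attribute [local instance] HasExt.standard

noncomputable section

namespace SerreEquiv

/-! ### Serre dualities -/

/-- A Serre duality on a Hom-finite `k`-linear abelian category `C`: a `k`-linear auto-equivalence
`S` and `k`-linear isomorphisms `D Ext¹(X, Y) ≅ Hom(Y, S X)`, natural in `X` and `Y`. -/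
structure SerreDuality (k : Type w) [Field k] (C : Type u) [Category.{v} C] [Abelian C]
    [Linear k C] [∀ X Y : C, FiniteDimensional k (X ⟶ Y)] where
  /-- The Serre functor. -/
  S : C ⥤ C
  isEquivalence : S.IsEquivalence
  additive : S.Additive
  linear : S.Linear k
  /-- The duality isomorphism. -/
  φ (X Y : C) : Module.Dual k (Ext X Y 1) ≃ₗ[k] (Y ⟶ S.obj X)
  /-- Naturality in `Y`: the dual of `[ξ] ↦ g.[ξ]` corresponds to precomposition with `g`. -/
  φ_naturality_right (X : C) {Y Y' : C} (g : Y' ⟶ Y) (l : Module.Dual k (Ext X Y 1)) :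
    φ X Y' (l ∘ₗ (Ext.mk₀ g).postcompOfLinear k X (add_zero 1)) = g ≫ φ X Y l
  /-- Naturality in `X`: the dual of `[ξ] ↦ [ξ].f` corresponds to postcomposition with `S f`. -/
  φ_naturality_left {X X' : C} (f : X ⟶ X') (Y : C) (l : Module.Dual k (Ext X Y 1)) :
    φ X' Y (l ∘ₗ (Ext.mk₀ f).precompOfLinear k Y (zero_add 1)) = φ X Y l ≫ S.map f

attribute [instance] SerreDuality.isEquivalence SerreDuality.additive SerreDuality.linear

namespace SerreDuality

variable {k : Type w} [Field k] {C : Type u} [Category.{v} C] [Abelian C] [Linear k C]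
  [∀ X Y : C, FiniteDimensional k (X ⟶ Y)] (D : SerreDuality k C)

/-- The trace map `Tr_X : Ext¹(X, S X) → k`. -/
def trace (X : C) : Module.Dual k (Ext X (D.S.obj X) 1) :=
  (D.φ X (D.S.obj X)).symm (𝟙 (D.S.obj X))

/-- `σ : F S ≅ S F` is the commutator isomorphism of the auto-equivalence `F`:
`Tr_X [ξ] = Tr_{F X} (σ_X.[F ξ])` for all `X` and `[ξ] ∈ Ext¹(X, S X)`. -/
def IsCommutator (F : C ⥤ C) [F.Additive] [F.IsEquivalence] (σ : D.S ⋙ F ≅ F ⋙ D.S) : Prop :=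
  ∀ (X : C) (ξ : Ext X (D.S.obj X) 1),
    D.trace X ξ =
      D.trace (F.obj X) ((ξ.mapExactFunctor F).comp (Ext.mk₀ (σ.hom.app X)) (add_zero 1))

/-- The Serre duality is perfect: the commutator isomorphism of `S` is the identity of `S²`. -/
def IsPerfect : Prop :=
  D.IsCommutator D.S (Iso.refl (D.S ⋙ D.S))

end SerreDuality

/-! ### Powers and periodicity of endofunctors -/

section Powers

variable {C : Type u} [Category.{v} C] (F : C ⥤ C)

/-- The `n`-th power of an endofunctor. -/
def endoPow : ℕ → (C ⥤ C)
  | 0 => 𝟭 C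
  | n + 1 => endoPow n ⋙ F

/-- `Fⁱ Fʲ = Fⁱ⁺ʲ`, as an equality of functors. -/
lemma endoPow_add (i j : ℕ) : endoPow F j ⋙ endoPow F i = endoPow F (i + j) := by
  induction i with
  | zero => rw [Nat.zero_add]; rfl
  | succ i ih =>
    rw [Nat.succ_add]
    change (endoPow F j ⋙ endoPow F i) ⋙ F = _
    rw [ih]; rfl

lemma endoPow_add_obj (i j : ℕ) (X : C) :
    (endoPow F i).obj ((endoPow F j).obj X) = (endoPow F (i + j)).obj X :=
  Functor.congr_obj (endoPow_add F i j) X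

lemma endoPow_obj_comm (d : ℕ) (X : C) :
    (endoPow F d).obj (F.obj X) = F.obj ((endoPow F d).obj X) :=
  endoPow_add_obj F d 1 X

/-- `d` is the order of `F`, i.e. the least `n ≥ 1` such that `Fⁿ` is isomorphic to the identity. -/
def HasOrder (d : ℕ) : Prop :=
  IsLeast {n : ℕ | 0 < n ∧ Nonempty (endoPow F n ≅ 𝟭 C)} d

/-- A periodicity isomorphism `θ : Fᵈ ≅ Id` is compatible if `θ F = F θ`; the `eqToHom` is the
identity `Fᵈ (F X) = F (Fᵈ X)`. -/
def IsCompatible {F : C ⥤ C} {d : ℕ} (θ : endoPow F d ≅ 𝟭 C) : Prop :=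
  ∀ X : C, θ.hom.app (F.obj X) =
    eqToHom (endoPow_obj_comm F d X) ≫ F.map (θ.hom.app X)

instance [h : F.IsEquivalence] (n : ℕ) : (endoPow F n).IsEquivalence := by
  induction n with
  | zero => exact inferInstanceAs (𝟭 C).IsEquivalence
  | succ n ih => exact inferInstanceAs (endoPow F n ⋙ F).IsEquivalence

instance [Preadditive C] [h : F.Additive] (n : ℕ) : (endoPow F n).Additive := by
  induction n with
  | zero => exact inferInstanceAs (𝟭 C).Additive
  | succ n ih => exact inferInstanceAs (endoPow F n ⋙ F).Additive

instance (k : Type w) [Semiring k] [Preadditive C] [Linear k C] [h : F.Linear k] (n : ℕ) :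
    (endoPow F n).Linear k := by
  induction n with
  | zero => exact inferInstanceAs ((𝟭 C).Linear k)
  | succ n ih => exact inferInstanceAs ((endoPow F n ⋙ F).Linear k)

end Powers

/-! ### Group actions on categories and equivariant objects -/

/-- A `k`-linear action of a group `G` on a `k`-linear category `C`. In Mathlib's order of
composition, `F h ⋙ F g` is the functor `F_g F_h`. -/
structure LinearAction (k : Type w) [Field k] (G : Type) [Group G] (C : Type u) [Category.{v} C]
    [Preadditive C] [Linear k C] where
  /-- The auto-equivalence `F_g`. -/
  F : G → (C ⥤ C)
  isEquivalence (g : G) : (F g).IsEquivalence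
  additive (g : G) : (F g).Additive
  linear (g : G) : (F g).Linear k
  /-- The isomorphism `F_g F_h ≅ F_{gh}`. -/
  ε (g h : G) : F h ⋙ F g ≅ F (g * h)
  /-- The 2-cocycle condition; the `eqToHom` is the identity `F_{(gh)l} X = F_{g(hl)} X`. -/
  cocycle (g h l : G) (X : C) :
    (ε g h).hom.app ((F l).obj X) ≫ (ε (g * h) l).hom.app X ≫
        eqToHom (congrArg (fun x => (F x).obj X) (mul_assoc g h l)) =
      (F g).map ((ε h l).hom.app X) ≫ (ε g (h * l)).hom.app X

attribute [instance] LinearAction.isEquivalence LinearAction.additive LinearAction.linear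

variable {k : Type w} [Field k] {G : Type} [Group G] {C : Type u} [Category.{v} C]

/-- A `G`-equivariant object of `C`. -/
structure EquivariantObject [Preadditive C] [Linear k C] (Φ : LinearAction k G C) where
  /-- The underlying object. -/
  X : C
  /-- The isomorphism `α_g : X ≅ F_g X`. -/
  α (g : G) : X ≅ (Φ.F g).obj X
  α_mul (g h : G) :
    (α (g * h)).hom = (α g).hom ≫ (Φ.F g).map (α h).hom ≫ (Φ.ε g h).hom.app X

namespace EquivariantObject

section Preadditive

variable [Preadditive C] [Linear k C] {Φ : LinearAction k G C}

/-- A morphism of `G`-equivariant objects. -/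
@[ext]
structure Hom (M N : EquivariantObject Φ) where
  /-- The underlying morphism. -/
  f : M.X ⟶ N.X
  comm (g : G) : f ≫ (N.α g).hom = (M.α g).hom ≫ (Φ.F g).map f

lemma Hom.comm_assoc {M N : EquivariantObject Φ} (f : Hom M N) (g : G) {Z : C}
    (h : (Φ.F g).obj N.X ⟶ Z) :
    f.f ≫ (N.α g).hom ≫ h = (M.α g).hom ≫ (Φ.F g).map f.f ≫ h := by
  rw [← Category.assoc, f.comm, Category.assoc]

instance : Category (EquivariantObject Φ) where
  Hom := Hom
  id M := ⟨𝟙 M.X, by simp⟩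
  comp f g := ⟨f.f ≫ g.f, by simp [Hom.comm, Hom.comm_assoc]⟩

@[simp] lemma id_f (M : EquivariantObject Φ) : Hom.f (𝟙 M) = 𝟙 M.X := rfl

@[simp] lemma comp_f {M N P : EquivariantObject Φ} (f : M ⟶ N) (g : N ⟶ P) :
    (f ≫ g).f = f.f ≫ g.f := rfl

@[ext] lemma hom_ext {M N : EquivariantObject Φ} {f g : M ⟶ N} (h : f.f = g.f) : f = g :=
  Hom.ext h

variable (Φ) in
/-- The forgetful functor. -/
def forget : EquivariantObject Φ ⥤ C where
  obj M := M.X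
  map f := f.f

instance : (forget Φ).Faithful := ⟨fun h => hom_ext h⟩

instance : (forget Φ).ReflectsIsomorphisms where
  reflects {M N} f hf := by
    have hf' : IsIso f.f := hf
    refine ⟨⟨⟨inv f.f, fun g => ?_⟩, ?_, ?_⟩⟩
    · have := f.comm g
      rw [IsIso.inv_comp_eq, reassoc_of% this, ← Functor.map_comp]
      simp
    · ext; simp
    · ext; simp

section Linear

variable (M N : EquivariantObject Φ)

instance : Zero (M ⟶ N) := ⟨⟨0, by simp⟩⟩
instance : Add (M ⟶ N) := ⟨fun f g => ⟨f.f + g.f, fun x => by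
  simp [Functor.map_add, f.comm, g.comm]⟩⟩
instance : Neg (M ⟶ N) := ⟨fun f => ⟨-f.f, fun x => by simp [Functor.map_neg, f.comm]⟩⟩
instance : Sub (M ⟶ N) := ⟨fun f g => ⟨f.f - g.f, fun x => by
  simp [Functor.map_sub, f.comm, g.comm]⟩⟩
instance : SMul k (M ⟶ N) := ⟨fun r f => ⟨r • f.f, fun x => by
  simp [Functor.map_smul, f.comm]⟩⟩

variable {M N}

@[simp] lemma zero_f : Hom.f (0 : M ⟶ N) = 0 := rfl
@[simp] lemma add_f (f g : M ⟶ N) : (f + g).f = f.f + g.f := rfl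
@[simp] lemma neg_f (f : M ⟶ N) : (-f).f = -f.f := rfl
@[simp] lemma sub_f (f g : M ⟶ N) : (f - g).f = f.f - g.f := rfl
@[simp] lemma smul_f (r : k) (f : M ⟶ N) : (r • f).f = r • f.f := rfl

variable (M N)

instance : AddCommGroup (M ⟶ N) where
  add_assoc f g h := by ext; simp [add_assoc]
  zero_add f := by ext; simp
  add_zero f := by ext; simp
  nsmul := nsmulRec
  zsmul := zsmulRec
  neg_add_cancel f := by ext; simp
  sub_eq_add_neg f g := by ext; simp [sub_eq_add_neg]
  add_comm f g := by ext; simp [add_comm]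

instance : Module k (M ⟶ N) where
  one_smul f := by ext; simp
  mul_smul a b f := by ext; simp [mul_smul]
  smul_zero a := by ext; simp
  smul_add a f g := by ext; simp
  add_smul a b f := by ext; simp [add_smul]
  zero_smul f := by ext; simp

end Linear

instance : Preadditive (EquivariantObject Φ) where
  add_comp _ _ _ f g h := by ext; simp
  comp_add _ _ _ f g h := by ext; simp

instance : Linear k (EquivariantObject Φ) where
  smul_comp _ _ _ r f g := by ext; simp
  comp_smul _ _ _ f r g := by ext; simp

instance : (forget Φ).Additive where

instance [∀ X Y : C, FiniteDimensional k (X ⟶ Y)] (M N : EquivariantObject Φ) :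
    FiniteDimensional k (M ⟶ N) :=
  FiniteDimensional.of_injective
    ({ toFun := fun f => f.f, map_add' := fun _ _ => rfl, map_smul' := fun _ _ => rfl } :
      (M ⟶ N) →ₗ[k] (M.X ⟶ N.X)) (fun _ _ h => hom_ext h)

/-! The forgetful functor creates limits and colimits, since the `F_g` preserve them. -/

section Limits

lemma limit_aux {L X : C} (p : L ⟶ X) (a : ∀ g, L ⟶ (Φ.F g).obj L) (b : ∀ g, X ⟶ (Φ.F g).obj X)
    (e : ∀ g, a g ≫ (Φ.F g).map p = p ≫ b g) (g h : G)
    (hb : b (g * h) = b g ≫ (Φ.F g).map (b h) ≫ (Φ.ε g h).hom.app X) :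
    a (g * h) ≫ (Φ.F (g * h)).map p =
      (a g ≫ (Φ.F g).map (a h) ≫ (Φ.ε g h).hom.app L) ≫ (Φ.F (g * h)).map p := by
  have n := (Φ.ε g h).hom.naturality p
  dsimp at n
  rw [e, Category.assoc, Category.assoc, ← n, ← Functor.map_comp_assoc, e,
      Functor.map_comp_assoc, reassoc_of% (e g), hb]

lemma colimit_aux {L X : C} (p : X ⟶ L) (a : ∀ g, L ⟶ (Φ.F g).obj L)
    (b : ∀ g, X ⟶ (Φ.F g).obj X) (e : ∀ g, p ≫ a g = b g ≫ (Φ.F g).map p) (g h : G)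
    (hb : b (g * h) = b g ≫ (Φ.F g).map (b h) ≫ (Φ.ε g h).hom.app X) :
    p ≫ a (g * h) = p ≫ a g ≫ (Φ.F g).map (a h) ≫ (Φ.ε g h).hom.app L := by
  have n := (Φ.ε g h).hom.naturality p
  dsimp at n
  rw [e, reassoc_of% (e g), ← Functor.map_comp_assoc, e, Functor.map_comp_assoc, n, hb]
  simp

lemma lift_aux {L X T : C} (p : L ⟶ X) (g : G) (a : L ⟶ (Φ.F g).obj L) (b : X ⟶ (Φ.F g).obj X)
    (e : a ≫ (Φ.F g).map p = p ≫ b) (t : T ⟶ (Φ.F g).obj T) (l : T ⟶ L) (q : T ⟶ X)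
    (hl : l ≫ p = q) (hq : q ≫ b = t ≫ (Φ.F g).map q) :
    (l ≫ a) ≫ (Φ.F g).map p = (t ≫ (Φ.F g).map l) ≫ (Φ.F g).map p := by
  rw [Category.assoc, e, Category.assoc, ← Functor.map_comp, hl, ← hq, ← hl, Category.assoc]

lemma desc_aux {L X T : C} (p : X ⟶ L) (g : G) (a : L ⟶ (Φ.F g).obj L) (b : X ⟶ (Φ.F g).obj X)
    (e : p ≫ a = b ≫ (Φ.F g).map p) (t : T ⟶ (Φ.F g).obj T) (l : L ⟶ T) (q : X ⟶ T)
    (hl : p ≫ l = q) (hq : q ≫ t = b ≫ (Φ.F g).map q) :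
    p ≫ l ≫ t = p ≫ a ≫ (Φ.F g).map l := by
  rw [reassoc_of% e, ← Functor.map_comp, hl, ← hq, ← hl, Category.assoc]

variable {J : Type} [SmallCategory J] (K : J ⥤ EquivariantObject Φ)

/-- The structure morphisms of a diagram of equivariant objects. -/
def diagIso (g : G) : K ⋙ forget Φ ≅ (K ⋙ forget Φ) ⋙ Φ.F g :=
  NatIso.ofComponents (fun j => (K.obj j).α g) (fun f => (K.map f).comm g)

/-- The equivariant structure on a limit in `C`. -/
def limitObj (c : Cone (K ⋙ forget Φ)) (hc : IsLimit c) : EquivariantObject Φ where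
  X := c.pt
  α g := hc.conePointsIsoOfNatIso (isLimitOfPreserves (Φ.F g) hc) (diagIso K g)
  α_mul g h := by
    exact (isLimitOfPreserves (Φ.F (g * h)) hc).hom_ext fun j =>
      limit_aux (c.π.app j) _ (fun g => ((K.obj j).α g).hom)
        (fun g => hc.conePointsIsoOfNatIso_hom_comp (isLimitOfPreserves (Φ.F g) hc) (diagIso K g) j)
        g h ((K.obj j).α_mul g h)

instance : CreatesLimitsOfShape J (forget Φ) where
  CreatesLimit {K} := createsLimitOfReflectsIso fun c hc =>
    { liftedCone :=
        { pt := limitObj K c hc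
          π :=
            { app := fun j => ⟨c.π.app j, fun g =>
                (hc.conePointsIsoOfNatIso_hom_comp
                  (isLimitOfPreserves (Φ.F g) hc) (diagIso K g) j).symm⟩
              naturality := fun _ _ f => hom_ext (c.π.naturality f) } }
      validLift := Cone.ext (Iso.refl _) (fun j => (Category.id_comp _).symm)
      makesLimit :=
        { lift := fun s => ⟨hc.lift ((forget Φ).mapCone s), fun g => by
            exact (isLimitOfPreserves (Φ.F g) hc).hom_ext fun j =>
              lift_aux (c.π.app j) g _ ((K.obj j).α g).hom
                (hc.conePointsIsoOfNatIso_hom_comp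
                  (isLimitOfPreserves (Φ.F g) hc) (diagIso K g) j)
                (s.pt.α g).hom (hc.lift ((forget Φ).mapCone s)) (s.π.app j).f
                (hc.fac ((forget Φ).mapCone s) j) ((s.π.app j).comm g)⟩
          fac := fun s j => hom_ext (hc.fac ((forget Φ).mapCone s) j)
          uniq := fun s m hm => hom_ext
            (hc.uniq ((forget Φ).mapCone s) m.f (fun j => congrArg Hom.f (hm j))) } }

/-- The equivariant structure on a colimit in `C`. -/
def colimitObj (c : Cocone (K ⋙ forget Φ)) (hc : IsColimit c) : EquivariantObject Φ where
  X := c.pt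
  α g := hc.coconePointsIsoOfNatIso (isColimitOfPreserves (Φ.F g) hc) (diagIso K g)
  α_mul g h := by
    exact hc.hom_ext fun j =>
      colimit_aux (c.ι.app j) _ (fun g => ((K.obj j).α g).hom)
        (fun g => hc.comp_coconePointsIsoOfNatIso_hom
          (isColimitOfPreserves (Φ.F g) hc) (diagIso K g) j)
        g h ((K.obj j).α_mul g h)

instance : CreatesColimitsOfShape J (forget Φ) where
  CreatesColimit {K} := createsColimitOfReflectsIso fun c hc =>
    { liftedCocone :=
        { pt := colimitObj K c hc
          ι :=
            { app := fun j => ⟨c.ι.app j, fun g =>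
                hc.comp_coconePointsIsoOfNatIso_hom
                  (isColimitOfPreserves (Φ.F g) hc) (diagIso K g) j⟩
              naturality := fun _ _ f => hom_ext (c.ι.naturality f) } }
      validLift := Cocone.ext (Iso.refl _) (fun j => Category.comp_id _)
      makesColimit :=
        { desc := fun s => ⟨hc.desc ((forget Φ).mapCocone s), fun g => by
            exact hc.hom_ext fun j =>
              desc_aux (c.ι.app j) g _ ((K.obj j).α g).hom
                (hc.comp_coconePointsIsoOfNatIso_hom
                  (isColimitOfPreserves (Φ.F g) hc) (diagIso K g) j)
                (s.pt.α g).hom (hc.desc ((forget Φ).mapCocone s)) (s.ι.app j).f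
                (hc.fac ((forget Φ).mapCocone s) j) ((s.ι.app j).comm g)⟩
          fac := fun s j => hom_ext (hc.fac ((forget Φ).mapCocone s) j)
          uniq := fun s m hm => hom_ext
            (hc.uniq ((forget Φ).mapCocone s) m.f (fun j => congrArg Hom.f (hm j))) } }

end Limits

end Preadditive

section Abelian

variable [Abelian C] [Linear k C] (Φ : LinearAction k G C)

instance : HasFiniteLimits (EquivariantObject Φ) :=
  ⟨fun _ _ _ => hasLimitsOfShape_of_hasLimitsOfShape_createsLimitsOfShape (forget Φ)⟩

instance : HasFiniteColimits (EquivariantObject Φ) :=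
  ⟨fun _ _ _ => hasColimitsOfShape_of_hasColimitsOfShape_createsColimitsOfShape (forget Φ)⟩

instance : PreservesFiniteLimits (forget Φ) := ⟨fun _ _ _ => inferInstance⟩

instance : PreservesFiniteColimits (forget Φ) := ⟨fun _ _ _ => inferInstance⟩

instance {M N : EquivariantObject Φ} (f : M ⟶ N) : IsIso (Abelian.coimageImageComparison f) := by
  have : IsIso ((forget Φ).map (Abelian.coimageImageComparison f)) :=
    ((MorphismProperty.isomorphisms C).arrow_mk_iso_iff
      (Abelian.PreservesCoimageImageComparison.iso (forget Φ) f)).2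
        (inferInstanceAs (IsIso (Abelian.coimageImageComparison ((forget Φ).map f))))
  exact isIso_of_reflects_iso _ (forget Φ)

instance : Abelian (EquivariantObject Φ) := Abelian.ofCoimageImageComparisonIsIso

end Abelian

end EquivariantObject

/-! ### The action of a cyclic group -/

section Cyclic

variable {F : C ⥤ C} {d : ℕ}

/-- `Fⁿ θ : Fⁿ⁺ᵈ X → Fⁿ X`. -/
def powθ (θ : endoPow F d ≅ 𝟭 C) (n : ℕ) (X : C) :
    (endoPow F (n + d)).obj X ⟶ (endoPow F n).obj X :=
  eqToHom (endoPow_add_obj F n d X).symm ≫ (endoPow F n).map (θ.hom.app X)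

lemma powθ_congr (θ : endoPow F d ≅ 𝟭 C) {m n : ℕ} (h : m = n) (X : C) :
    powθ θ m X = eqToHom (by rw [h]) ≫ powθ θ n X ≫ eqToHom (by rw [h]) := by
  subst h; simp

lemma endoPow_map_eq (m n : ℕ) {X Y : C} (f : X ⟶ Y) :
    (endoPow F m).map ((endoPow F n).map f) =
      eqToHom (endoPow_add_obj F m n X) ≫ (endoPow F (m + n)).map f ≫
        eqToHom (endoPow_add_obj F m n Y).symm :=
  Functor.congr_hom (endoPow_add F m n) f

lemma map_powθ (θ : endoPow F d ≅ 𝟭 C) (m n : ℕ) (X : C) :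
    (endoPow F m).map (powθ θ n X) =
      eqToHom (by rw [endoPow_add_obj, add_assoc]) ≫ powθ θ (m + n) X ≫
        eqToHom (endoPow_add_obj F m n X).symm := by
  simp [powθ, endoPow_map_eq, eqToHom_map]

lemma IsCompatible.app_pow {θ : endoPow F d ≅ 𝟭 C} (hθ : IsCompatible θ) (l : ℕ) (X : C) :
    θ.hom.app ((endoPow F l).obj X) =
      eqToHom (by rw [endoPow_add_obj, endoPow_add_obj, add_comm]) ≫
        (endoPow F l).map (θ.hom.app X) := by
  induction l with
  | zero => exact (Category.id_comp _).symm
  | succ l ih =>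
    change θ.hom.app (F.obj ((endoPow F l).obj X)) = _ ≫ F.map ((endoPow F l).map (θ.hom.app X))
    rw [hθ, ih, Functor.map_comp, eqToHom_map, eqToHom_trans_assoc]
    rfl

lemma powθ_obj {θ : endoPow F d ≅ 𝟭 C} (hθ : IsCompatible θ) (n l : ℕ) (X : C) :
    powθ θ n ((endoPow F l).obj X) =
      eqToHom (by rw [endoPow_add_obj, add_right_comm]) ≫ powθ θ (n + l) X ≫
        eqToHom (endoPow_add_obj F n l X).symm := by
  simp [powθ, hθ.app_pow, endoPow_map_eq, eqToHom_map]

variable [NeZero d]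

/-- The isomorphism `Fⁱ Fʲ ≅ F^[i+j]` for `0 ≤ i, j < d`, where `[i+j]` is the residue of `i + j`
modulo `d`: it is the identity if `i + j < d`, and `F^(i+j-d) θ` otherwise. -/
def cyclicε (θ : endoPow F d ≅ 𝟭 C) (i j : ZMod d) :
    endoPow F j.val ⋙ endoPow F i.val ≅ endoPow F (i + j).val :=
  if h : i.val + j.val < d then
    eqToIso (by rw [endoPow_add, ZMod.val_add_of_lt h])
  else
    eqToIso (by rw [endoPow_add, endoPow_add, Nat.sub_add_cancel (not_lt.1 h)]) ≪≫
      Functor.isoWhiskerRight θ (endoPow F (i.val + j.val - d)) ≪≫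
      eqToIso (by rw [Functor.id_comp, ZMod.val_add_of_le (not_lt.1 h)])

lemma cyclicε_of_lt (θ : endoPow F d ≅ 𝟭 C) (i j : ZMod d) (h : i.val + j.val < d) (X : C) :
    (cyclicε θ i j).hom.app X =
      eqToHom (by
        rw [ZMod.val_add_of_lt h]; exact endoPow_add_obj F _ _ X) := by
  simp [cyclicε, h, eqToHom_app]

lemma cyclicε_of_le (θ : endoPow F d ≅ 𝟭 C) (i j : ZMod d) (n : ℕ) (h : i.val + j.val = n + d)
    (X : C) :
    (cyclicε θ i j).hom.app X =
      eqToHom (by rw [← h]; exact endoPow_add_obj F _ _ X) ≫ powθ θ n X ≫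
        eqToHom (by rw [ZMod.val_add_of_le (by omega), h, Nat.add_sub_cancel]) := by
  obtain rfl : n = i.val + j.val - d := by omega
  have h' : ¬ i.val + j.val < d := by omega
  simp [cyclicε, h', eqToHom_app, powθ]

lemma cyclicε_cocycle {θ : endoPow F d ≅ 𝟭 C} (hθ : IsCompatible θ) (i j l : ZMod d) (X : C) :
    (cyclicε θ i j).hom.app ((endoPow F l.val).obj X) ≫ (cyclicε θ (i + j) l).hom.app X ≫
        eqToHom (by rw [add_assoc]) =
      (endoPow F i.val).map ((cyclicε θ j l).hom.app X) ≫ (cyclicε θ i (j + l)).hom.app X := by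
  have hi := ZMod.val_lt i
  have hj := ZMod.val_lt j
  have hl := ZMod.val_lt l
  by_cases hij : i.val + j.val < d <;> by_cases hjl : j.val + l.val < d
  · have e1 := ZMod.val_add_of_lt hij
    have e2 := ZMod.val_add_of_lt hjl
    rw [cyclicε_of_lt θ i j hij, cyclicε_of_lt θ j l hjl]
    by_cases h : i.val + j.val + l.val < d
    · rw [cyclicε_of_lt θ (i + j) l (by omega), cyclicε_of_lt θ i (j + l) (by omega)]
      simp [eqToHom_map]
    · have hn : i.val + j.val + l.val = (i.val + j.val + l.val - d) + d := by omega
      rw [cyclicε_of_le θ (i + j) l _ (by rw [e1]; exact hn),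
        cyclicε_of_le θ i (j + l) _ (by rw [e2, ← add_assoc]; exact hn)]
      simp [eqToHom_map]
  · have e1 := ZMod.val_add_of_lt hij
    have e2 := ZMod.val_add_of_le (not_lt.1 hjl)
    have hn : j.val + l.val = (j.val + l.val - d) + d := by omega
    rw [cyclicε_of_lt θ i j hij, cyclicε_of_le θ j l _ hn,
      cyclicε_of_le θ (i + j) l (i.val + (j.val + l.val - d)) (by omega),
      cyclicε_of_lt θ i (j + l) (by omega)]
    simp [eqToHom_map, map_powθ]
  · have e1 := ZMod.val_add_of_le (not_lt.1 hij)
    have e2 := ZMod.val_add_of_lt hjl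
    have hn : i.val + j.val = (i.val + j.val - d) + d := by omega
    rw [cyclicε_of_le θ i j _ hn, cyclicε_of_lt θ j l hjl,
      cyclicε_of_lt θ (i + j) l (by omega),
      cyclicε_of_le θ i (j + l) ((i.val + j.val - d) + l.val) (by omega)]
    simp [eqToHom_map, powθ_obj hθ]
  · have e1 := ZMod.val_add_of_le (not_lt.1 hij)
    have e2 := ZMod.val_add_of_le (not_lt.1 hjl)
    have hn : i.val + j.val = (i.val + j.val - d) + d := by omega
    have hm : j.val + l.val = (j.val + l.val - d) + d := by omega
    rw [cyclicε_of_le θ i j _ hn, cyclicε_of_le θ j l _ hm]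
    simp only [Functor.map_comp, map_powθ, powθ_obj hθ, eqToHom_map,
      powθ_congr θ (show (i.val + j.val - d) + l.val = i.val + (j.val + l.val - d) by omega)]
    by_cases h : (i.val + j.val - d) + l.val < d
    · rw [cyclicε_of_lt θ (i + j) l (by omega), cyclicε_of_lt θ i (j + l) (by omega)]
      simp
    · rw [cyclicε_of_le θ (i + j) l (i.val + j.val + l.val - d - d) (by omega),
        cyclicε_of_le θ i (j + l) (i.val + j.val + l.val - d - d) (by omega)]
      simp

/-- The `k`-linear action of the cyclic group `C_d` on `C` that is induced by an auto-equivalence `F`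
and a compatible periodicity isomorphism `θ : Fᵈ ≅ Id`. The generator `g` of `C_d` is the class
of `1` in `ℤ/d`, and `F_{gⁱ} = Fⁱ` for `0 ≤ i < d`. -/
def cyclicAction (k : Type w) [Field k] [Preadditive C] [Linear k C] [F.IsEquivalence]
    [F.Additive] [F.Linear k] (θ : endoPow F d ≅ 𝟭 C) (hθ : IsCompatible θ) :
    LinearAction k (Multiplicative (ZMod d)) C where
  F g := endoPow F g.toAdd.val
  isEquivalence _ := inferInstance
  additive _ := inferInstance
  linear _ := inferInstance
  ε g h := cyclicε θ g.toAdd h.toAdd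
  cocycle g h l X := cyclicε_cocycle hθ g.toAdd h.toAdd l.toAdd X

/-- The equivariantization of `C` with respect to the `C_d`-action induced by `F` and `θ`. -/
abbrev CyclicEquivariantization (k : Type w) [Field k] [Preadditive C] [Linear k C]
    [F.IsEquivalence] [F.Additive] [F.Linear k] (θ : endoPow F d ≅ 𝟭 C) (hθ : IsCompatible θ) :
    Type (max u v) :=
  EquivariantObject (cyclicAction k θ hθ)

end Cyclic

end SerreEquiv

end

/-! A Serre duality is determined by its traces: the functional on `Ext¹(X, Y)` attached to `f : Y ⟶
S X` is `ξ ↦ Tr_X (push ξ f)`, and these functionals separate morphisms (`φ_symm_apply`,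
`hom_ext_of_trace`). Perfectness says that `Tr` is unchanged by `S`, hence by every `Sⁿ`
(`trace_endoPow`).

Compatibility of `η` amounts to an endomorphism of `S X` being the identity, so it may be tested
under `Tr_X`. Naturality of `η` on `Ext¹` and the exchange rule `trace_pull` reduce the test to `Tr
(S^d ξ) = Tr ξ`.

An equivariant object carries an isomorphism `a : X ≅ S X`, the structure map of the generator. It
turns the trace of `A` into a functional `ξ ↦ Tr_X (push ξ a)` on equivariant self-extensions. This
functional is symmetric because equivariant morphisms commute with `a`. The form is invariant under
the group because `S` preserves traces and, the group being commutative, all structure maps commute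
with `a`.

Nondegeneracy is an averaging argument in the style of Maschke. The composite `M ⟶ Ind M ⟶ M` is
multiplication by `d`, so for `d` invertible the forgetful functor is injective on `Ext¹` and norms
of classes and of morphisms are equivariant (`exists_underlying_eq_sum`, `exists_f_eq_sum`). The
form therefore gives a Serre duality with Serre functor the identity (`equivariantDuality`), and
Serre functors are unique up to isomorphism (`comparisonIso`). -/

noncomputable section

namespace SerreEquiv

/-! ### Degree one extensions and exact functors -/

section ExtOne

universe w₁ w₂ w₃ v₁ v₂ v₃ u₁ u₂ u₃

variable {A : Type u₁} [Category.{v₁} A] [Abelian A] [HasExt.{w₁} A]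
  {B : Type u₂} [Category.{v₂} B] [Abelian B] [HasExt.{w₂} B]
  {C : Type u₃} [Category.{v₃} C] [Abelian C] [HasExt.{w₃} C]

/-- The push-out of a class in `Ext¹` along a morphism. -/
def push {X Y Z : A} (ξ : Ext X Y 1) (f : Y ⟶ Z) : Ext X Z 1 :=
  ξ.comp (Ext.mk₀ f) (add_zero 1)

/-- The pull-back of a class in `Ext¹` along a morphism. -/
def pull {X Y Z : A} (f : X ⟶ Y) (ξ : Ext Y Z 1) : Ext X Z 1 :=
  (Ext.mk₀ f).comp ξ (zero_add 1)

lemma push_push {X Y Z T : A} (ξ : Ext X Y 1) (f : Y ⟶ Z) (g : Z ⟶ T) :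
    push (push ξ f) g = push ξ (f ≫ g) := by
  rw [push, push, push, Ext.comp_assoc_of_third_deg_zero, Ext.mk₀_comp_mk₀]

lemma pull_pull {X Y Z T : A} (f : X ⟶ Y) (g : Y ⟶ Z) (ξ : Ext Z T 1) :
    pull f (pull g ξ) = pull (f ≫ g) ξ :=
  Ext.mk₀_comp_mk₀_assoc f g ξ

lemma push_pull {X Y Z T : A} (f : X ⟶ Y) (ξ : Ext Y Z 1) (g : Z ⟶ T) :
    push (pull f ξ) g = pull f (push ξ g) :=
  Ext.comp_assoc_of_third_deg_zero _ _ _ _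

@[simp] lemma push_id {X Y : A} (ξ : Ext X Y 1) : push ξ (𝟙 Y) = ξ := Ext.comp_mk₀_id ξ

@[simp] lemma pull_id {X Y : A} (ξ : Ext X Y 1) : pull (𝟙 X) ξ = ξ := Ext.mk₀_id_comp ξ

@[simp] lemma zero_push {X Y Z : A} (f : Y ⟶ Z) : push (0 : Ext X Y 1) f = 0 := by simp [push]

@[simp] lemma pull_zero {X Y Z : A} (f : X ⟶ Y) : pull f (0 : Ext Y Z 1) = 0 := by simp [pull]

lemma push_sum {X Y Z : A} {ι : Type*} [Fintype ι] (ξ : Ext X Y 1) (f : ι → (Y ⟶ Z)) :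
    push ξ (∑ i, f i) = ∑ i, push ξ (f i) := by
  rw [push, Ext.mk₀_sum, Ext.comp_sum]
  rfl

lemma sum_pull {X Y Z : A} {ι : Type*} [Fintype ι] (f : ι → (X ⟶ Y)) (ξ : Ext Y Z 1) :
    pull (∑ i, f i) ξ = ∑ i, pull (f i) ξ := by
  rw [pull, Ext.mk₀_sum, Ext.sum_comp]
  rfl

lemma sum_push {X Y Z : A} {ι : Type*} [Fintype ι] (ξ : ι → Ext X Y 1) (f : Y ⟶ Z) :
    push (∑ i, ξ i) f = ∑ i, push (ξ i) f :=
  Ext.sum_comp _ _ _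

lemma push_smul {k : Type*} [Ring k] [Linear k A] {X Y Z : A} (ξ : Ext X Y 1) (r : k)
    (f : Y ⟶ Z) : push ξ (r • f) = r • push ξ f := by
  simp [push, Ext.mk₀_smul]

/-- Every class in `Ext¹` is effaced by an epimorphism. -/
lemma exists_epi_pull_eq_zero {X Y : A} (ξ : Ext X Y 1) :
    ∃ (E : A) (p : E ⟶ X), Epi p ∧ pull p ξ = 0 := by
  let := HasDerivedCategory.standard A
  -- The triangle `Y ⟶ Z ⟶ X ⟶ Y⟦1⟧` is completed from its connecting map `ξ`. Both ends lie in the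
  -- heart, hence so does `Z`, which is the middle term of the extension.
  obtain ⟨Z, f, g, hT⟩ := Pretriangulated.distinguished_cocone_triangle₂ ξ.hom
  have hLE : Z.IsLE 0 := DerivedCategory.TStructure.t.isLE₂ _ hT 0
    (inferInstanceAs (((DerivedCategory.singleFunctor A 0).obj Y).IsLE 0))
    (inferInstanceAs (((DerivedCategory.singleFunctor A 0).obj X).IsLE 0))
  have hGE : Z.IsGE 0 := DerivedCategory.TStructure.t.isGE₂ _ hT 0
    (inferInstanceAs (((DerivedCategory.singleFunctor A 0).obj Y).IsGE 0))
    (inferInstanceAs (((DerivedCategory.singleFunctor A 0).obj X).IsGE 0))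
  obtain ⟨E, ⟨e⟩⟩ := DerivedCategory.exists_iso_singleFunctor_obj_of_isGE_of_isLE Z 0
  obtain ⟨p, hp⟩ := (DerivedCategory.singleFunctor A 0).map_surjective (e.inv ≫ g)
  refine ⟨E, p, ?_, ?_⟩
  · have hg : Epi ((DerivedCategory.homologyFunctor A 0).map g) :=
      (DerivedCategory.HomologySequence.epi_homologyMap_mor₂_iff _ hT 0 1).2
        ((DerivedCategory.isZero_of_isLE ((DerivedCategory.singleFunctor A 0).obj Y) 0 1
          (by lia)).eq_of_tgt _ _)
    have : Epi ((DerivedCategory.homologyFunctor A 0).map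
        ((DerivedCategory.singleFunctor A 0).map p)) := by
      rw [hp, Functor.map_comp]
      infer_instance
    exact ((MorphismProperty.epimorphisms A).arrow_mk_iso_iff
      (((Functor.mapArrowFunctor _ _).mapIso
        (DerivedCategory.singleFunctorCompHomologyFunctorIso A 0)).app (Arrow.mk p))).1 this
  · ext
    rw [pull, Ext.comp_hom, Ext.mk₀_hom, hp, ShiftedHom.mk₀_comp, Category.assoc]
    have h₀ : g ≫ ξ.hom = 0 := Pretriangulated.comp_distTriang_mor_zero₂₃ _ hT
    rw [h₀, comp_zero, Ext.zero_hom]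

/-- Every class in `Ext¹` is a push-out of the class of a short exact sequence. -/
lemma exists_eq_push_extClass {X Y : A} (ξ : Ext X Y 1) :
    ∃ (K E : A) (i : K ⟶ E) (p : E ⟶ X) (w : i ≫ p = 0)
      (h : (ShortComplex.mk i p w).ShortExact) (f : K ⟶ Y),
      ξ = push h.extClass f := by
  obtain ⟨E, p, _, hp⟩ := exists_epi_pull_eq_zero ξ
  have h : (ShortComplex.mk (kernel.ι p) p (kernel.condition p)).ShortExact :=
    { exact := ShortComplex.exact_kernel p }
  -- Since `ξ` dies on `E`, the long exact sequence of `Hom(-, Y)` makes it the image of a morphism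
  -- `K ⟶ Y` under the connecting map.
  obtain ⟨x, hx⟩ := Ext.contravariant_sequence_exact₃ h Y ξ hp (add_zero 1)
  obtain ⟨f, rfl⟩ := (Ext.mk₀_bijective _ _).2 x
  exact ⟨_, _, _, _, _, h, f, hx.symm⟩

section

variable (F G : A ⥤ B) [F.Additive] [PreservesFiniteLimits F] [PreservesFiniteColimits F]
  [G.Additive] [PreservesFiniteLimits G] [PreservesFiniteColimits G]

lemma map_push {X Y Z : A} (ξ : Ext X Y 1) (f : Y ⟶ Z) :
    (push ξ f).mapExactFunctor F = push (ξ.mapExactFunctor F) (F.map f) := by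
  rw [push, Ext.mapExactFunctor_comp, Ext.mapExactFunctor_mk₀, push]

lemma map_pull {X Y Z : A} (f : X ⟶ Y) (ξ : Ext Y Z 1) :
    (pull f ξ).mapExactFunctor F = pull (F.map f) (ξ.mapExactFunctor F) := by
  rw [pull, Ext.mapExactFunctor_comp, Ext.mapExactFunctor_mk₀, pull]

variable {F G} in
/-- Natural transformations between exact functors are natural with respect to `Ext¹`. -/
lemma map_push_app (θ : F ⟶ G) {X Y : A} (ξ : Ext X Y 1) :
    push (ξ.mapExactFunctor F) (θ.app Y) = pull (θ.app X) (ξ.mapExactFunctor G) := by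
  -- Both sides respect push-outs, which leaves the class of a short exact sequence; there `θ` is a
  -- morphism between the two image sequences.
  obtain ⟨K, E, i, p, w, h, f, rfl⟩ := exists_eq_push_extClass ξ
  let e : Ext X K 1 := h.extClass
  have key : push (e.mapExactFunctor F) (θ.app K) = pull (θ.app X) (e.mapExactFunctor G) := by
    have hF : e.mapExactFunctor F = (h.map_of_exact F).extClass := Ext.mapExactFunctor_extClass F h
    have hG : e.mapExactFunctor G = (h.map_of_exact G).extClass := Ext.mapExactFunctor_extClass G h
    rw [hF, hG]
    exact ShortComplex.ShortExact.extClass_naturality (h.map_of_exact F) (h.map_of_exact G)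
      ((ShortComplex.mk i p w).mapNatTrans θ)
  change push ((push e f).mapExactFunctor F) _ = pull _ ((push e f).mapExactFunctor G)
  rw [map_push, map_push, push_push, θ.naturality, ← push_push, key, push_pull]

end

/-- On the class of a short exact sequence both sides are the class of the same image sequence; the
general case follows by push-out. -/
lemma mapExactFunctor_functor_comp (F : A ⥤ B) (G : B ⥤ C) [F.Additive] [PreservesFiniteLimits F]
    [PreservesFiniteColimits F] [G.Additive] [PreservesFiniteLimits G] [PreservesFiniteColimits G]
    {X Y : A} (ξ : Ext X Y 1) :
    ξ.mapExactFunctor (F ⋙ G) = (ξ.mapExactFunctor F).mapExactFunctor G := by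
  obtain ⟨K, E, i, p, w, h, f, rfl⟩ := exists_eq_push_extClass ξ
  let e : Ext X K 1 := h.extClass
  have key : (e.mapExactFunctor F).mapExactFunctor G = e.mapExactFunctor (F ⋙ G) := by
    have hF : e.mapExactFunctor F = (h.map_of_exact F).extClass := Ext.mapExactFunctor_extClass F h
    rw [hF]
    exact (Ext.mapExactFunctor_extClass G (h.map_of_exact F)).trans
      (Ext.mapExactFunctor_extClass (F ⋙ G) h).symm
  change (push e f).mapExactFunctor (F ⋙ G) = ((push e f).mapExactFunctor F).mapExactFunctor G
  rw [map_push, map_push, map_push, key]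
  rfl

lemma mapExactFunctor_functor_id {X Y : A} (ξ : Ext X Y 1) :
    ξ.mapExactFunctor (𝟭 A) = ξ := by
  obtain ⟨K, E, i, p, w, h, f, rfl⟩ := exists_eq_push_extClass ξ
  rw [map_push, Ext.mapExactFunctor_extClass]
  rfl

end ExtOne

/-! ### Trace maps -/

namespace SerreDuality

variable {k : Type w} [Field k] {C : Type u} [Category.{v} C] [Abelian C] [Linear k C]
  [∀ X Y : C, FiniteDimensional k (X ⟶ Y)] (D : SerreDuality k C)

/-- The Yoneda argument: naturality in `Y`, applied to the functional that corresponds to the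
identity of `S X`. -/
lemma φ_trace_postcomp {X Y : C} (f : Y ⟶ D.S.obj X) :
    D.φ X Y (D.trace X ∘ₗ (Ext.mk₀ f).postcompOfLinear k X (add_zero 1)) = f := by
  rw [D.φ_naturality_right, trace, LinearEquiv.apply_symm_apply, Category.comp_id]

lemma φ_symm_apply {X Y : C} (f : Y ⟶ D.S.obj X) (ξ : Ext X Y 1) :
    (D.φ X Y).symm f ξ = D.trace X (push ξ f) := by
  conv_lhs => rw [← D.φ_trace_postcomp f, LinearEquiv.symm_apply_apply]
  rfl

lemma trace_push_φ {X Y : C} (l : Module.Dual k (Ext X Y 1)) (ξ : Ext X Y 1) :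
    D.trace X (push ξ (D.φ X Y l)) = l ξ := by
  rw [← φ_symm_apply, LinearEquiv.symm_apply_apply]

/-- Under `φ` both functionals correspond to `S f`. -/
lemma trace_precomp {X X' : C} (f : X ⟶ X') :
    D.trace X ∘ₗ (Ext.mk₀ f).precompOfLinear k (D.S.obj X) (zero_add 1) =
      D.trace X' ∘ₗ (Ext.mk₀ (D.S.map f)).postcompOfLinear k X' (add_zero 1) := by
  apply (D.φ X' (D.S.obj X)).injective
  rw [φ_trace_postcomp, D.φ_naturality_left, trace, LinearEquiv.apply_symm_apply,
    Category.id_comp]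

/-- The exchange rule of the whole proof: a pull-back under the trace becomes a push-out along the
image by `S`. -/
lemma trace_pull {X X' : C} (f : X ⟶ X') (ξ : Ext X' (D.S.obj X) 1) :
    D.trace X (pull f ξ) = D.trace X' (push ξ (D.S.map f)) :=
  LinearMap.congr_fun (D.trace_precomp f) ξ

lemma hom_ext_of_trace {X Y : C} {f g : Y ⟶ D.S.obj X}
    (h : ∀ ξ : Ext X Y 1, D.trace X (push ξ f) = D.trace X (push ξ g)) : f = g := by
  apply (D.φ X Y).symm.injective
  ext ξ
  rw [φ_symm_apply, φ_symm_apply, h]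

/-- The comparison morphism between the Serre functors of two Serre dualities. -/
def comparison (D' : SerreDuality k C) : D.S ⟶ D'.S where
  app X := D'.φ X (D.S.obj X) (D.trace X)
  naturality X X' f := by
    rw [← D'.φ_naturality_right, ← D'.φ_naturality_left, trace_precomp]

lemma comparison_comp (D' : SerreDuality k C) :
    D.comparison D' ≫ D'.comparison D = 𝟙 D.S := by
  ext X
  apply D.hom_ext_of_trace
  intro ξ
  change D.trace X (push ξ (D'.φ X (D.S.obj X) (D.trace X) ≫
    D.φ X (D'.S.obj X) (D'.trace X))) = _
  -- One factor turns the trace of `D` into that of `D'`, the other turns it back.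
  rw [← push_push, trace_push_φ, trace_push_φ]
  exact congrArg (D.trace X) (push_id ξ).symm

/-- The Serre functor is unique up to isomorphism. -/
def comparisonIso (D' : SerreDuality k C) : D.S ≅ D'.S where
  hom := D.comparison D'
  inv := D'.comparison D
  hom_inv_id := D.comparison_comp D'
  inv_hom_id := D'.comparison_comp D

/-- A family of trace maps on `Ext¹(X, X)` that is symmetric and induces perfect pairings between
`Hom(Y, X)` and `Ext¹(X, Y)` is a Serre duality with the identity as Serre functor. -/
def ofTrace (t : ∀ X : C, Module.Dual k (Ext X X 1))
    (symm : ∀ {X X' : C} (f : X ⟶ X') (ξ : Ext X' X 1),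
      t X (pull f ξ) = t X' (push ξ f))
    (injective : ∀ {X Y : C} (f : Y ⟶ X),
      (∀ ξ : Ext X Y 1, t X (push ξ f) = 0) → f = 0)
    (surjective : ∀ {X Y : C} (l : Module.Dual k (Ext X Y 1)), ∃ f : Y ⟶ X,
      ∀ ξ : Ext X Y 1, t X (push ξ f) = l ξ) :
    SerreDuality k C :=
  let ψ (X Y : C) : (Y ⟶ X) →ₗ[k] Module.Dual k (Ext X Y 1) :=
    { toFun := fun f => t X ∘ₗ (Ext.mk₀ f).postcompOfLinear k X (add_zero 1)
      map_add' := fun f g => by ext ξ; simp [Ext.mk₀_add]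
      map_smul' := fun r f => by ext ξ; simp [Ext.mk₀_smul] }
  have hψ (X Y : C) : Function.Bijective (ψ X Y) :=
    ⟨(injective_iff_map_eq_zero _).2 fun f hf => injective f (LinearMap.congr_fun hf),
      fun l => (surjective l).imp fun _ hf => LinearMap.ext hf⟩
  { S := 𝟭 C
    isEquivalence := inferInstance
    additive := inferInstance
    linear := inferInstance
    φ := fun X Y => (LinearEquiv.ofBijective (ψ X Y) (hψ X Y)).symm
    φ_naturality_right := fun X Y Y' g l => by
      obtain ⟨f, rfl⟩ := (LinearEquiv.ofBijective (ψ X Y) (hψ X Y)).surjective l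
      rw [LinearEquiv.symm_apply_apply, LinearEquiv.symm_apply_eq]
      ext ξ
      change t X (push (push ξ g) f) = t X (push ξ (g ≫ f))
      rw [push_push]
    φ_naturality_left := fun {X X'} f Y l => by
      obtain ⟨g, rfl⟩ := (LinearEquiv.ofBijective (ψ X Y) (hψ X Y)).surjective l
      rw [LinearEquiv.symm_apply_apply, LinearEquiv.symm_apply_eq]
      ext ξ
      change t X (push (pull f ξ) g) = t X' (push ξ (g ≫ f))
      -- With the identity as Serre functor, naturality in `X` is the symmetry of the trace.
      rw [push_pull, symm, push_push] }

/-! ### Perfect Serre dualities -/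

variable {D}

lemma IsPerfect.trace_map (h : D.IsPerfect) {X : C} (ξ : Ext X (D.S.obj X) 1) :
    D.trace (D.S.obj X) (ξ.mapExactFunctor D.S) = D.trace X ξ := by
  rw [h X ξ]
  exact congrArg _ (push_id _).symm

/-- Invariance under `S` is iterated; the `eqToHom` only moves the class from `Sⁿ (S X)` to `S (Sⁿ
X)`, where the trace is defined. -/
lemma IsPerfect.trace_endoPow (h : D.IsPerfect) (n : ℕ) {X : C} (ξ : Ext X (D.S.obj X) 1) :
    D.trace ((endoPow D.S n).obj X) (push (ξ.mapExactFunctor (endoPow D.S n))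
      (eqToHom (endoPow_obj_comm D.S n X))) = D.trace X ξ := by
  induction n with
  | zero =>
    change D.trace X (push (ξ.mapExactFunctor (𝟭 C)) (𝟙 _)) = _
    rw [push_id, mapExactFunctor_functor_id]
  | succ n ih =>
    conv_rhs => rw [← ih, ← h.trace_map, map_push, eqToHom_map, ← mapExactFunctor_functor_comp]
    rfl

/-- Every periodicity isomorphism of the Serre functor of a perfect Serre duality is
compatible. -/
theorem IsPerfect.isCompatible (h : D.IsPerfect) {d : ℕ} (η : endoPow D.S d ≅ 𝟭 C) :
    IsCompatible η := by
  intro X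
  set e := eqToHom (endoPow_obj_comm D.S d X)
  -- Stated as an equality of endomorphisms of `S X`, compatibility can be checked under `Tr_X`.
  suffices η.inv.app (D.S.obj X) ≫ e ≫ D.S.map (η.hom.app X) = 𝟙 (D.S.obj X) by
    rw [← cancel_epi (η.inv.app (D.S.obj X)), this, Iso.inv_hom_id_app]
    rfl
  refine D.hom_ext_of_trace (X := X) (Y := D.S.obj X) fun ξ => ?_
  have hη : pull (η.inv.app X) (ξ.mapExactFunctor (endoPow D.S d)) =
      push ξ (η.inv.app (D.S.obj X)) := by
    rw [← map_push_app, mapExactFunctor_functor_id]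
  calc D.trace X (push ξ (η.inv.app (D.S.obj X) ≫ e ≫ D.S.map (η.hom.app X)))
      = D.trace X (push (push (push ξ (η.inv.app (D.S.obj X))) e)
          (D.S.map (η.hom.app X))) := by
        rw [push_push, push_push]
    -- `S η_X` is exchanged for a pull-back along `η_X`, which cancels the `η_X⁻¹` coming from `hη`
    -- and leaves the trace of `S^d ξ`.
    _ = D.trace _ (pull (η.hom.app X) (push (pull (η.inv.app X)
          (ξ.mapExactFunctor (endoPow D.S d))) e)) := by
        rw [hη]
        exact (D.trace_pull _ _).symm
    _ = D.trace X ξ := by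
        rw [push_pull, pull_pull, Iso.hom_inv_id_app, pull_id, h.trace_endoPow]
    _ = D.trace X (push ξ (𝟙 (D.S.obj X))) := by rw [push_id]

end SerreDuality

/-! ### Induction of equivariant objects -/

attribute [local instance] Abelian.hasFiniteBiproducts

/-! ### Finite direct sums of exact functors -/

section Sum

variable {ι : Type} [Finite ι] {C : Type u} [Category.{v} C] [Abelian C]

/-- A morphism to the image of a biproduct under an additive functor is determined by its
components. -/
lemma map_biproduct_hom_ext {B : Type*} [Category* B] [Preadditive B] (F : C ⥤ B) [F.Additive]
    (X : ι → C) {Z : B} {f g : Z ⟶ F.obj (⨁ X)}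
    (h : ∀ i, f ≫ F.map (biproduct.π X i) = g ≫ F.map (biproduct.π X i)) : f = g := by
  have := Fintype.ofFinite ι
  rw [← Category.comp_id f, ← Category.comp_id g, ← F.map_id, ← biproduct.total]
  simp only [Functor.map_sum, Functor.map_comp, Preadditive.comp_sum, reassoc_of% h]

/-- A morphism from the image of a biproduct under an additive functor is determined by its
components. -/
lemma map_biproduct_hom_ext' {B : Type*} [Category* B] [Preadditive B] (F : C ⥤ B) [F.Additive]
    (X : ι → C) {Z : B} {f g : F.obj (⨁ X) ⟶ Z}
    (h : ∀ i, F.map (biproduct.ι X i) ≫ f = F.map (biproduct.ι X i) ≫ g) : f = g := by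
  have := Fintype.ofFinite ι
  rw [← Category.id_comp f, ← Category.id_comp g, ← F.map_id, ← biproduct.total]
  simp only [Functor.map_sum, Functor.map_comp, Preadditive.sum_comp, Category.assoc, h]

variable (F : ι → (C ⥤ C))

/-- The direct sum of a finite family of endofunctors. -/
def sumFunctor : C ⥤ C where
  obj X := ⨁ fun i => (F i).obj X
  map f := biproduct.map fun i => (F i).map f

/-- The inclusion of a summand. -/
def sumι (i : ι) : F i ⟶ sumFunctor F where
  app X := biproduct.ι (fun i => (F i).obj X) i
  naturality _ _ f := (biproduct.ι_map (fun i => (F i).map f) i).symm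

instance [∀ i, (F i).Additive] : (sumFunctor F).Additive where
  map_add {X Y f g} := by
    apply biproduct.hom_ext
    intro j
    change biproduct.map (fun i => (F i).map (f + g)) ≫ _ =
      (biproduct.map (fun i => (F i).map f) + biproduct.map (fun i => (F i).map g)) ≫ _
    simp

/-- The direct sum as a composition with a limit functor. -/
def sumFunctorIso : sumFunctor F ≅ (Discrete.functor F).flip ⋙ lim :=
  NatIso.ofComponents
    (fun X => biproduct.isoProduct _ ≪≫
      HasLimit.isoOfNatIso (Discrete.natIso fun _ => Iso.refl _))
    (fun f => by
      apply limit.hom_ext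
      rintro ⟨j⟩
      simp [sumFunctor])

/-- Exactness of the direct sum is obtained through `sumFunctorIso`: limits and colimits in the
functor category are pointwise, where each `F i` preserves them. -/
instance (K : Type) [SmallCategory K] [FinCategory K] [∀ i, PreservesFiniteLimits (F i)] :
    PreservesLimitsOfShape K (Discrete.functor F).flip :=
  preservesLimitsOfShape_of_evaluation _ _ fun i =>
    inferInstanceAs (PreservesLimitsOfShape K (F i.as))

instance (K : Type) [SmallCategory K] [FinCategory K] [∀ i, PreservesFiniteColimits (F i)] :
    PreservesColimitsOfShape K (Discrete.functor F).flip :=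
  preservesColimitsOfShape_of_evaluation _ _ fun i =>
    inferInstanceAs (PreservesColimitsOfShape K (F i.as))

instance [∀ i, PreservesFiniteLimits (F i)] : PreservesFiniteLimits (sumFunctor F) where
  preservesFiniteLimits _ _ _ := preservesLimitsOfShape_of_natIso (sumFunctorIso F).symm

instance [∀ i, PreservesFiniteColimits (F i)] : PreservesFiniteColimits (sumFunctor F) where
  preservesFiniteColimits _ _ _ := preservesColimitsOfShape_of_natIso (sumFunctorIso F).symm

end Sum

/-! ### The induction functor and the maps `M ⟶ Ind M ⟶ M` -/

namespace EquivariantObject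

variable {k : Type w} [Field k] {G : Type} [Group G] [Fintype G] {C : Type u} [Category.{v} C]
  [Abelian C] [Linear k C] (Φ : LinearAction k G C)

lemma π_eqToHom {ι : Type} [Finite ι] (X : ι → C) {i j : ι} (h : i = j) :
    biproduct.π X i ≫ eqToHom (congrArg X h) = biproduct.π X j := by
  subst h; simp

/-- The morphism `F_g (⨁ F_h X) ⟶ ⨁ F_h X` permuting the summands. -/
def indInv (X : C) (g : G) :
    (Φ.F g).obj (⨁ fun h => (Φ.F h).obj X) ⟶ ⨁ fun h => (Φ.F h).obj X :=
  ∑ h, (Φ.F g).map (biproduct.π (fun h => (Φ.F h).obj X) h) ≫ (Φ.ε g h).hom.app X ≫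
    biproduct.ι (fun h => (Φ.F h).obj X) (g * h)

lemma map_ι_indInv (X : C) (g h : G) :
    (Φ.F g).map (biproduct.ι (fun h => (Φ.F h).obj X) h) ≫ indInv Φ X g =
      (Φ.ε g h).hom.app X ≫ biproduct.ι (fun h => (Φ.F h).obj X) (g * h) := by
  rw [indInv, Preadditive.comp_sum, Finset.sum_eq_single h]
  · rw [← Functor.map_comp_assoc, biproduct.ι_π_self]
    simp
  · intro j _ hj
    rw [← Functor.map_comp_assoc, biproduct.ι_π_ne _ hj.symm]
    simp
  · simp

lemma map_ι_indInv_assoc (X : C) (g h : G) {Z : C} (f : (⨁ fun h => (Φ.F h).obj X) ⟶ Z) :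
    (Φ.F g).map (biproduct.ι (fun h => (Φ.F h).obj X) h) ≫ indInv Φ X g ≫ f =
      (Φ.ε g h).hom.app X ≫ biproduct.ι (fun h => (Φ.F h).obj X) (g * h) ≫ f := by
  rw [← Category.assoc, map_ι_indInv, Category.assoc]

/-- The morphism `⨁ F_h X ⟶ F_g (⨁ F_h X)` permuting the summands. -/
def indHom (X : C) (g : G) :
    (⨁ fun h => (Φ.F h).obj X) ⟶ (Φ.F g).obj (⨁ fun h => (Φ.F h).obj X) :=
  ∑ h, biproduct.π (fun h => (Φ.F h).obj X) (g * h) ≫ (Φ.ε g h).inv.app X ≫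
    (Φ.F g).map (biproduct.ι (fun h => (Φ.F h).obj X) h)

lemma indHom_map_π (X : C) (g h : G) :
    indHom Φ X g ≫ (Φ.F g).map (biproduct.π (fun h => (Φ.F h).obj X) h) =
      biproduct.π (fun h => (Φ.F h).obj X) (g * h) ≫ (Φ.ε g h).inv.app X := by
  rw [indHom, Preadditive.sum_comp, Finset.sum_eq_single h]
  · rw [Category.assoc, Category.assoc, ← Functor.map_comp, biproduct.ι_π_self]
    simp
  · intro j _ hj
    rw [Category.assoc, Category.assoc, ← Functor.map_comp, biproduct.ι_π_ne _ hj]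
    simp
  · simp

lemma indHom_map_π_assoc (X : C) (g h : G) {Z : C} (f : (Φ.F g).obj ((Φ.F h).obj X) ⟶ Z) :
    indHom Φ X g ≫ (Φ.F g).map (biproduct.π (fun h => (Φ.F h).obj X) h) ≫ f =
      biproduct.π (fun h => (Φ.F h).obj X) (g * h) ≫ (Φ.ε g h).inv.app X ≫ f := by
  rw [← Category.assoc, indHom_map_π, Category.assoc]

lemma indInv_comp_indHom (X : C) (g : G) : indInv Φ X g ≫ indHom Φ X g = 𝟙 _ := by
  apply map_biproduct_hom_ext'
  intro h
  apply map_biproduct_hom_ext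
  intro l
  rw [Category.comp_id, ← Functor.map_comp, Category.assoc, Category.assoc, indHom_map_π,
    map_ι_indInv_assoc]
  by_cases hl : h = l
  · subst hl; simp
  · rw [biproduct.ι_π_ne _ hl, biproduct.ι_π_ne_assoc _ (by simpa using hl)]
    simp

lemma indHom_comp_indInv (X : C) (g : G) : indHom Φ X g ≫ indInv Φ X g = 𝟙 _ := by
  simp only [indInv, Preadditive.comp_sum, indHom_map_π_assoc, Iso.inv_hom_id_app_assoc]
  rw [← biproduct.total]
  exact Fintype.sum_equiv (Equiv.mulLeft g) _ _ fun _ => rfl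

/-- The isomorphism `⨁ F_h X ≅ F_g (⨁ F_h X)` permuting the summands. -/
def indα (X : C) (g : G) :
    (⨁ fun h => (Φ.F h).obj X) ≅ (Φ.F g).obj (⨁ fun h => (Φ.F h).obj X) where
  hom := indHom Φ X g
  inv := indInv Φ X g
  hom_inv_id := indHom_comp_indInv Φ X g
  inv_hom_id := indInv_comp_indHom Φ X g

/-- On the component indexed by `l` this is the cocycle condition for `g`, `h`, `l`, read with
inverses as in `c'`. -/
lemma indHom_mul (X : C) (g h : G) :
    indHom Φ X (g * h) = indHom Φ X g ≫ (Φ.F g).map (indHom Φ X h) ≫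
      (Φ.ε g h).hom.app (⨁ fun h => (Φ.F h).obj X) := by
  apply map_biproduct_hom_ext
  intro l
  have n : (Φ.F g).map ((Φ.F h).map (biproduct.π (fun h => (Φ.F h).obj X) l)) ≫
      (Φ.ε g h).hom.app ((Φ.F l).obj X) =
    (Φ.ε g h).hom.app (⨁ fun h => (Φ.F h).obj X) ≫
      (Φ.F (g * h)).map (biproduct.π (fun h => (Φ.F h).obj X) l) :=
    (Φ.ε g h).hom.naturality (biproduct.π (fun h => (Φ.F h).obj X) l)
  have c := Φ.cocycle g h l X
  have c' : (Φ.ε g (h * l)).inv.app X ≫ (Φ.F g).map ((Φ.ε h l).inv.app X) ≫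
      (Φ.ε g h).hom.app ((Φ.F l).obj X) =
      eqToHom (congrArg (fun x => (Φ.F x).obj X) (mul_assoc g h l).symm) ≫
        (Φ.ε (g * h) l).inv.app X := by
    rw [← cancel_mono ((Φ.ε (g * h) l).hom.app X), Category.assoc, Category.assoc, Category.assoc,
      Iso.inv_hom_id_app, ← cancel_mono (eqToHom (congrArg (fun x => (Φ.F x).obj X)
        (mul_assoc g h l)))]
    simp only [Category.assoc, c]
    simp [← Functor.map_comp_assoc]
  rw [Category.assoc, Category.assoc, indHom_map_π, ← n, ← Functor.map_comp_assoc,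
    indHom_map_π, Functor.map_comp_assoc, indHom_map_π_assoc, c',
    ← π_eqToHom (fun h => (Φ.F h).obj X) (mul_assoc g h l).symm, Category.assoc]

/-- The induced equivariant object `⨁ F_h X`. -/
def indObj (X : C) : EquivariantObject Φ where
  X := ⨁ fun h => (Φ.F h).obj X
  α := indα Φ X
  α_mul := indHom_mul Φ X

/-- The induction functor. -/
def ind : C ⥤ EquivariantObject Φ where
  obj := indObj Φ
  map {X Y} f := ⟨biproduct.map fun h => (Φ.F h).map f, fun g => by
    change biproduct.map (fun h => (Φ.F h).map f) ≫ indHom Φ Y g =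
      indHom Φ X g ≫ (Φ.F g).map (biproduct.map fun h => (Φ.F h).map f)
    apply map_biproduct_hom_ext
    intro h
    rw [Category.assoc, indHom_map_π, Category.assoc, ← Functor.map_comp, biproduct.map_π,
      biproduct.map_π_assoc, Functor.map_comp, indHom_map_π_assoc]
    congr 1
    exact (Φ.ε g h).inv.naturality f⟩
  map_id X := hom_ext ((sumFunctor Φ.F).map_id X)
  map_comp f g := hom_ext ((sumFunctor Φ.F).map_comp f g)

instance : (ind Φ).Additive where
  map_add {_ _ f g} := hom_ext ((sumFunctor Φ.F).map_add (f := f) (g := g))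

instance : PreservesFiniteLimits (ind Φ) where
  preservesFiniteLimits K _ _ :=
    have : PreservesLimitsOfShape K (ind Φ ⋙ forget Φ) :=
      inferInstanceAs (PreservesLimitsOfShape K (sumFunctor Φ.F))
    have : ReflectsLimitsOfShape K (forget Φ) := reflectsLimitsOfShape_of_reflectsIsomorphisms
    preservesLimitsOfShape_of_reflects_of_preserves (ind Φ) (forget Φ)

instance : PreservesFiniteColimits (ind Φ) where
  preservesFiniteColimits K _ _ :=
    have : PreservesColimitsOfShape K (ind Φ ⋙ forget Φ) :=
      inferInstanceAs (PreservesColimitsOfShape K (sumFunctor Φ.F))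
    have : ReflectsColimitsOfShape K (forget Φ) := reflectsColimitsOfShape_of_reflectsIsomorphisms
    preservesColimitsOfShape_of_reflects_of_preserves (ind Φ) (forget Φ)

/-- The morphism `M ⟶ Ind M` with components `α_h`. -/
def toInd : 𝟭 (EquivariantObject Φ) ⟶ forget Φ ⋙ ind Φ where
  app M := ⟨biproduct.lift fun h => (M.α h).hom, fun g => by
    change (biproduct.lift fun h => (M.α h).hom) ≫ indHom Φ M.X g =
      (M.α g).hom ≫ (Φ.F g).map (biproduct.lift fun h => (M.α h).hom)
    apply map_biproduct_hom_ext
    intro h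
    rw [Category.assoc, indHom_map_π, Category.assoc, ← Functor.map_comp, biproduct.lift_π,
      biproduct.lift_π_assoc, M.α_mul]
    simp⟩
  naturality M N f := by
    apply hom_ext
    change f.f ≫ (biproduct.lift fun h => (N.α h).hom) =
      (biproduct.lift fun h => (M.α h).hom) ≫ biproduct.map fun h => (Φ.F h).map f.f
    apply biproduct.hom_ext
    intro h
    simp [f.comm]

/-- The morphism `Ind M ⟶ M` with components `α_h⁻¹`. -/
def fromInd : forget Φ ⋙ ind Φ ⟶ 𝟭 (EquivariantObject Φ) where
  app M := ⟨biproduct.desc fun h => (M.α h).inv, fun g => by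
    change (biproduct.desc fun h => (M.α h).inv) ≫ (M.α g).hom =
      (indα Φ M.X g).hom ≫ (Φ.F g).map (biproduct.desc fun h => (M.α h).inv)
    rw [← Iso.inv_comp_eq]
    apply map_biproduct_hom_ext'
    intro h
    change _ ≫ indInv Φ M.X g ≫ _ = _
    rw [map_ι_indInv_assoc, biproduct.ι_desc_assoc, ← Functor.map_comp, biproduct.ι_desc,
      ← cancel_epi ((Φ.F g).map (M.α h).hom), ← cancel_epi (M.α g).hom]
    have := M.α_mul g h
    rw [← reassoc_of% this]
    simp [← Functor.map_comp]⟩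
  naturality M N f := by
    apply hom_ext
    change (biproduct.map fun h => (Φ.F h).map f.f) ≫ (biproduct.desc fun h => (N.α h).inv) =
      (biproduct.desc fun h => (M.α h).inv) ≫ f.f
    apply biproduct.hom_ext'
    intro h
    have := f.comm h
    rw [biproduct.ι_map_assoc, biproduct.ι_desc, biproduct.ι_desc_assoc,
      ← cancel_epi (M.α h).hom, ← reassoc_of% this]
    simp

/-- Each `h` contributes `α_h` followed by its inverse. When the order of `G` is invertible, this
makes `M` a direct summand of `Ind M`. -/
lemma toInd_comp_fromInd (M : EquivariantObject Φ) :
    (toInd Φ).app M ≫ (fromInd Φ).app M = (Fintype.card G : k) • 𝟙 M := by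
  apply hom_ext
  change (biproduct.lift fun h => (M.α h).hom) ≫ (biproduct.desc fun h => (M.α h).inv) =
    (Fintype.card G : k) • 𝟙 M.X
  rw [biproduct.lift_desc]
  simp [Nat.cast_smul_eq_nsmul]

end EquivariantObject

namespace EquivariantObject

/-! ### Transfer -/

variable {k : Type w} [Field k] {G : Type} [Group G] {C : Type u} [Category.{v} C]
  [Abelian C] [Linear k C] {Φ : LinearAction k G C}

instance : (forget Φ).Linear k where
  map_smul _ _ := rfl

/-- The map on `Ext¹` induced by the forgetful functor. -/
def underlying {M N : EquivariantObject Φ} : Ext M N 1 →ₗ[k] Ext M.X N.X 1 :=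
  (forget Φ).mapExtLinearMap k M N 1

lemma underlying_push {M N P : EquivariantObject Φ} (ξ : Ext M N 1) (f : N ⟶ P) :
    underlying (push ξ f) = push (underlying ξ) f.f :=
  map_push (forget Φ) ξ f

lemma underlying_pull {M N P : EquivariantObject Φ} (f : M ⟶ N) (ξ : Ext N P 1) :
    underlying (pull f ξ) = pull f.f (underlying ξ) :=
  map_pull (forget Φ) f ξ

variable (Φ) in
/-- The structure morphisms, as a natural transformation. -/
def αNatTrans (g : G) : forget Φ ⟶ forget Φ ⋙ Φ.F g where
  app M := (M.α g).hom
  naturality _ _ f := f.comm g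

/-- Classes coming from the equivariantization are `G`-invariant, because the `α_g` form a natural
transformation of exact functors. -/
lemma push_underlying_α {M N : EquivariantObject Φ} (ξ : Ext M N 1) (g : G) :
    push (underlying ξ) (N.α g).hom =
      pull (M.α g).hom ((underlying ξ).mapExactFunctor (Φ.F g)) := by
  have h : (underlying ξ).mapExactFunctor (Φ.F g) = ξ.mapExactFunctor (forget Φ ⋙ Φ.F g) :=
    (mapExactFunctor_functor_comp (forget Φ) (Φ.F g) ξ).symm
  rw [h]
  exact map_push_app (αNatTrans Φ g) ξ

section

variable [∀ X Y : C, FiniteDimensional k (X ⟶ Y)] (D : SerreDuality k C)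
  (a : ∀ M : EquivariantObject Φ, M.X ≅ D.S.obj M.X)

/-- The trace maps on the equivariantization. -/
def equivariantTrace (M : EquivariantObject Φ) : Module.Dual k (Ext M M 1) :=
  D.trace M.X ∘ₗ (Ext.mk₀ (a M).hom).postcompOfLinear k M.X (add_zero 1) ∘ₗ underlying

lemma equivariantTrace_apply {M : EquivariantObject Φ} (ξ : Ext M M 1) :
    equivariantTrace D a M ξ = D.trace M.X (push (underlying ξ) (a M).hom) := rfl

end

variable [Fintype G]

/-- If the order of the group is invertible, a class in `Ext¹` vanishes as soon as the underlying
class does. -/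
lemma eq_zero_of_underlying_eq_zero (hG : (Fintype.card G : k) ≠ 0) {M N : EquivariantObject Φ}
    {ξ : Ext M N 1} (h : underlying ξ = 0) : ξ = 0 := by
  -- By naturality this push-out is a pull-back of `Ind` applied to the underlying class, which is
  -- zero.
  have h₁ : push ξ ((toInd Φ).app N) = 0 := by
    have := map_push_app (toInd Φ) ξ
    rw [mapExactFunctor_functor_id, mapExactFunctor_functor_comp,
      show ξ.mapExactFunctor (forget Φ) = 0 from h, Ext.mapExactFunctor_zero, pull_zero] at this
    exact this
  have h₂ : (Fintype.card G : k) • ξ = 0 := by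
    calc (Fintype.card G : k) • ξ = push ξ ((Fintype.card G : k) • 𝟙 N) := by
          rw [push_smul, push_id]
      _ = push (push ξ ((toInd Φ).app N)) ((fromInd Φ).app N) := by
          rw [← toInd_comp_fromInd, push_push]
      _ = 0 := by rw [h₁, zero_push]
  exact (smul_eq_zero.1 h₂).resolve_left hG

/-- The norm of a class in `Ext¹` comes from an equivariant class. -/
lemma exists_underlying_eq_sum {M N : EquivariantObject Φ} (ξ : Ext M.X N.X 1) :
    ∃ ζ : Ext M N 1, underlying ζ =
      ∑ g, push (pull (M.α g).hom (ξ.mapExactFunctor (Φ.F g))) (N.α g).inv := by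
  let i : M ⟶ (ind Φ).obj M.X := (toInd Φ).app M
  let p : (ind Φ).obj N.X ⟶ N := (fromInd Φ).app N
  refine ⟨push (pull i (ξ.mapExactFunctor (ind Φ))) p, ?_⟩
  have h : underlying (ξ.mapExactFunctor (ind Φ)) = ξ.mapExactFunctor (sumFunctor Φ.F) :=
    (mapExactFunctor_functor_comp (ind Φ) (forget Φ) ξ).symm
  let i' : M.X ⟶ (sumFunctor Φ.F).obj M.X := i.f
  let p' : (sumFunctor Φ.F).obj N.X ⟶ N.X := p.f
  have h₀ : underlying (push (pull i (ξ.mapExactFunctor (ind Φ))) p) =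
      push (pull i' (ξ.mapExactFunctor (sumFunctor Φ.F))) p' := by
    rw [underlying_push, underlying_pull, h]
    rfl
  have h₁ : i' = ∑ g, (M.α g).hom ≫ (sumι Φ.F g).app M.X :=
    biproduct.lift_eq
  have h₂ (g : G) : (sumι Φ.F g).app N.X ≫ p' = (N.α g).inv :=
    biproduct.ι_desc _ _
  rw [h₀, h₁, sum_pull, sum_push]
  refine Finset.sum_congr rfl fun g _ => ?_
  -- The inclusion `F_g ⟶ ⨁ F_h` is natural on `Ext¹`, which isolates the summand of index `g`.
  rw [← pull_pull, ← map_push_app, push_pull, push_push, h₂, ← push_pull]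

/-- The norm of a morphism is equivariant. -/
lemma exists_f_eq_sum {M N : EquivariantObject Φ} (f : M.X ⟶ N.X) :
    ∃ f' : M ⟶ N, f'.f = ∑ g, (M.α g).hom ≫ (Φ.F g).map f ≫ (N.α g).inv := by
  refine ⟨(toInd Φ).app M ≫ (ind Φ).map f ≫ (fromInd Φ).app N, ?_⟩
  change (biproduct.lift fun h => (M.α h).hom) ≫ (biproduct.map fun h => (Φ.F h).map f) ≫
    (biproduct.desc fun h => (N.α h).inv) = _
  rw [biproduct.map_desc, biproduct.lift_desc]

/-! ### Serre duality on the equivariantization -/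

section

variable [∀ X Y : C, FiniteDimensional k (X ⟶ Y)] (D : SerreDuality k C)
  (a : ∀ M : EquivariantObject Φ, M.X ≅ D.S.obj M.X)

/-- A natural isomorphism `M ≅ S M` of underlying objects, whose trace forms are invariant under
the group, induces a Serre duality on the equivariantization with the
identity as Serre functor. -/
def equivariantDuality (hG : (Fintype.card G : k) ≠ 0)
    (nat : ∀ {M N : EquivariantObject Φ} (f : M ⟶ N),
      f.f ≫ (a N).hom = (a M).hom ≫ D.S.map f.f)
    (ha : ∀ (M : EquivariantObject Φ) (g : G) (ξ : Ext M.X M.X 1),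
      D.trace M.X (push (pull (M.α g).hom (ξ.mapExactFunctor (Φ.F g)))
        ((M.α g).inv ≫ (a M).hom)) = D.trace M.X (push ξ ((a M).hom))) :
    SerreDuality k (EquivariantObject Φ) :=
  SerreDuality.ofTrace (equivariantTrace D a)
    (fun {M N} f ξ => by
      rw [equivariantTrace_apply, equivariantTrace_apply, underlying_pull, underlying_push,
        push_pull, push_push, D.trace_pull, push_push, nat])
    (fun {M N} f hf => by
      have h₀ : f.f ≫ (a M).hom = 0 := by
        refine D.hom_ext_of_trace (X := M.X) (Y := N.X) fun ξ => ?_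
        -- The test class `ξ` need not be equivariant. Its norm is, and by invariance each term
        -- pairs with `f` as `ξ` does, so the hypothesis on `f` gives the order of `G` times the
        -- wanted trace.
        obtain ⟨ζ, hζ⟩ := exists_underlying_eq_sum ξ
        have key := hf ζ
        rw [equivariantTrace_apply, underlying_push, hζ, sum_push, sum_push, map_sum] at key
        have hterm (g : G) : D.trace M.X (push (push (push (pull (M.α g).hom
            (ξ.mapExactFunctor (Φ.F g))) (N.α g).inv) f.f) ((a M).hom)) =
            D.trace M.X (push ξ (f.f ≫ (a M).hom)) := by
          have hc : (N.α g).inv ≫ f.f = (Φ.F g).map f.f ≫ (M.α g).inv := by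
            rw [Iso.inv_comp_eq, ← Category.assoc, Iso.eq_comp_inv, f.comm]
          have := ha M g (push ξ f.f)
          rw [map_push, ← push_pull, push_push, push_push] at this
          rw [push_push, push_push, reassoc_of% hc, this]
        rw [Finset.sum_congr rfl fun g _ => hterm g, Finset.sum_const, Finset.card_univ,
          ← Nat.cast_smul_eq_nsmul k, smul_eq_zero] at key
        rw [key.resolve_left hG]
        simp [push]
      apply hom_ext
      rw [← cancel_mono (a M).hom, h₀]
      simp)
    (fun {M N} l => by
      have hinj : Function.Injective (underlying (M := M) (N := N)) :=
        (injective_iff_map_eq_zero _).2 fun ξ hξ => eq_zero_of_underlying_eq_zero hG hξ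
      -- A linear retraction extends `l` to all of `Ext¹(M.X, N.X)`. Duality in `C` represents the
      -- extension by some `f'`, not necessarily equivariant, which is then averaged.
      obtain ⟨r, hr⟩ := LinearMap.exists_leftInverse_of_injective _ (LinearMap.ker_eq_bot.2 hinj)
      have hr' (ξ : Ext M N 1) : r (underlying ξ) = ξ := LinearMap.congr_fun hr ξ
      obtain ⟨f', hf'⟩ : ∃ f' : N.X ⟶ M.X, ∀ ξ : Ext M N 1,
          D.trace M.X (push (underlying ξ) (f' ≫ (a M).hom)) = l ξ := by
        refine ⟨D.φ M.X N.X (l ∘ₗ r) ≫ (a M).inv, fun ξ => ?_⟩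
        rw [Category.assoc, Iso.inv_hom_id, Category.comp_id, D.trace_push_φ,
          LinearMap.comp_apply, hr']
      obtain ⟨f, hf⟩ := exists_f_eq_sum f'
      refine ⟨(Fintype.card G : k)⁻¹ • f, fun ξ => ?_⟩
      have hterm (g : G) : D.trace M.X (push (push (underlying ξ)
          ((N.α g).hom ≫ (Φ.F g).map f' ≫ (M.α g).inv)) ((a M).hom)) = l ξ := by
        -- As the underlying class of `ξ` is itself invariant, conjugating `f'` by `g` does not
        -- change its pairing with `ξ`.
        have := ha M g (push (underlying ξ) f')
        rw [map_push, push_pull, push_push, ← push_pull, ← push_underlying_α, push_push,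
          push_push] at this
        rw [← hf', ← this, push_push, Category.assoc, Category.assoc]
      rw [push_smul, map_smul, equivariantTrace_apply, underlying_push, hf, push_sum, sum_push,
        map_sum, Finset.sum_congr rfl fun g _ => hterm g, Finset.sum_const, Finset.card_univ,
        ← Nat.cast_smul_eq_nsmul k, inv_smul_smul₀ hG])

end

end EquivariantObject

/-! ### Cyclic actions -/

section Cyclic

variable {C : Type u} [Category.{v} C] {F : C ⥤ C} {d : ℕ} [NeZero d]

/-- Both the carry condition and the exponent of `θ` depend only on `i.val + j.val`. -/
lemma cyclicε_comm (θ : endoPow F d ≅ 𝟭 C) (i j : ZMod d) (X : C) :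
    (cyclicε θ i j).hom.app X =
      eqToHom (by simp only [Functor.comp_obj, endoPow_add_obj, add_comm]) ≫
        (cyclicε θ j i).hom.app X ≫ eqToHom (by rw [add_comm]) := by
  by_cases h : i.val + j.val < d
  · rw [cyclicε_of_lt θ i j h, cyclicε_of_lt θ j i (by omega)]
    simp
  · rw [cyclicε_of_le θ i j (i.val + j.val - d) (by omega),
      cyclicε_of_le θ j i (i.val + j.val - d) (by omega)]
    simp

lemma endoPow_map_of_eq_one {n : ℕ} (h : n = 1) {X Y : C} (f : X ⟶ Y) :
    (endoPow F n).map f ≫ eqToHom (by rw [h]; rfl) =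
      eqToHom (by rw [h]; rfl) ≫ F.map f := by
  subst h
  exact (Category.comp_id _).trans (Category.id_comp _).symm

/-- The structure morphisms of an equivariant object commute with the one of the generator. -/
lemma cyclic_comm (θ : endoPow F d ≅ 𝟭 C) (hd : (1 : ZMod d).val = 1) {X : C}
    (β : ∀ i : ZMod d, X ≅ (endoPow F i.val).obj X)
    (hβ : ∀ i j, (β (i + j)).hom =
      (β i).hom ≫ (endoPow F i.val).map (β j).hom ≫ (cyclicε θ i j).hom.app X)
    (i : ZMod d) :
    ((β 1).hom ≫ eqToHom (by rw [hd]; rfl)) ≫ F.map (β i).hom =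
      (β i).hom ≫ (endoPow F i.val).map ((β 1).hom ≫ eqToHom (by rw [hd]; rfl)) ≫
        eqToHom (endoPow_obj_comm F i.val X) := by
  -- The structure map at `1 + i = i + 1` is expanded in both orders; by `cyclicε_comm` the same
  -- isomorphism `ε` can be cancelled.
  have hcast : (β (1 + i)).hom = (β (i + 1)).hom ≫ eqToHom (by rw [add_comm]) := by
    generalize_proofs h
    revert h
    rw [add_comm 1 i]
    simp
  have key : (β 1).hom ≫ (endoPow F (1 : ZMod d).val).map (β i).hom =
      (β i).hom ≫ (endoPow F i.val).map (β 1).hom ≫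
        eqToHom (by simp only [endoPow_add_obj, add_comm]) := by
    rw [hβ, hβ, cyclicε_comm θ 1 i] at hcast
    simp only [Category.assoc] at hcast
    rw [← cancel_mono (eqToHom (by simp only [Functor.comp_obj, endoPow_add_obj, add_comm]) ≫
      (cyclicε θ i 1).hom.app X ≫ eqToHom (by rw [add_comm]))]
    simpa using hcast
  rw [Category.assoc, ← endoPow_map_of_eq_one hd, reassoc_of% key]
  simp [eqToHom_map]

variable {k : Type w} [Field k] [Abelian C] [Linear k C] [F.IsEquivalence] [F.Additive]
  [F.Linear k]

/-- The underlying object of an equivariant object is naturally isomorphic to its image under the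
generator of the action, and this isomorphism is equivariant. -/
lemma exists_generator_iso (θ : endoPow F d ≅ 𝟭 C) (hθ : IsCompatible θ) :
    ∃ a : ∀ M : CyclicEquivariantization k θ hθ, M.X ≅ F.obj M.X,
      (∀ {M N : CyclicEquivariantization k θ hθ} (f : M ⟶ N),
        f.f ≫ (a N).hom = (a M).hom ≫ F.map f.f) ∧
      ∀ (M : CyclicEquivariantization k θ hθ) (i : ZMod d),
        (a M).hom ≫ F.map (M.α (Multiplicative.ofAdd i)).hom =
          (M.α (Multiplicative.ofAdd i)).hom ≫ (endoPow F i.val).map (a M).hom ≫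
            eqToHom (endoPow_obj_comm F i.val M.X) := by
  obtain rfl | hd := eq_or_ne d 1
  -- In `ℤ/1` the class of `1` has representative `0`, so the generator acts by the identity and not
  -- by `F`. Here `θ : F ≅ Id` itself supplies the isomorphism.
  · refine ⟨fun M => (θ.app M.X).symm, fun f => θ.inv.naturality f.f, fun M i => ?_⟩
    obtain rfl : i = 0 := Subsingleton.elim _ _
    refine (θ.inv.naturality (M.α (Multiplicative.ofAdd 0)).hom).symm.trans ?_
    exact congrArg (fun x => (M.α (Multiplicative.ofAdd 0)).hom ≫ x) (Category.comp_id _).symm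
  · have : Fact (1 < d) := ⟨by have := NeZero.ne d; omega⟩
    have h₁ : (1 : ZMod d).val = 1 := ZMod.val_one d
    have e (X : C) : (endoPow F (1 : ZMod d).val).obj X = F.obj X := by rw [h₁]; rfl
    let β (M : CyclicEquivariantization k θ hθ) (i : ZMod d) : M.X ≅ (endoPow F i.val).obj M.X :=
      M.α (Multiplicative.ofAdd i)
    refine ⟨fun M => β M 1 ≪≫ eqToIso (e M.X), fun {M N} f => ?_, fun M i => ?_⟩
    · have hf : f.f ≫ (β N 1).hom = (β M 1).hom ≫ (endoPow F (1 : ZMod d).val).map f.f :=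
        f.comm (Multiplicative.ofAdd 1)
      simp only [Iso.trans_hom, eqToIso.hom, Category.assoc]
      rw [reassoc_of% hf, endoPow_map_of_eq_one h₁]
    · exact cyclic_comm θ h₁ (β M) (fun i j => M.α_mul _ _) i

end Cyclic

/-- The equivariantization with respect to a periodicity isomorphism of the Serre functor of a
perfect Serre duality has a Serre duality with the identity as Serre functor. -/
theorem SerreDuality.IsPerfect.exists_equivariantDuality {k : Type w} [Field k] {C : Type u}
    [Category.{v} C] [Abelian C] [Linear k C] [∀ X Y : C, FiniteDimensional k (X ⟶ Y)]
    {D : SerreDuality k C} (h : D.IsPerfect) {d : ℕ} [NeZero d] (hd : (d : k) ≠ 0)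
    (η : endoPow D.S d ≅ 𝟭 C) (hη : IsCompatible η) :
    ∃ E : SerreDuality k (CyclicEquivariantization k η hη), E.S = 𝟭 _ := by
  obtain ⟨a, nat, comm⟩ := exists_generator_iso (k := k) η hη
  refine ⟨EquivariantObject.equivariantDuality D a (by simpa [ZMod.card] using hd) nat
    fun M g ξ => ?_, rfl⟩
  let n := g.toAdd.val
  let α : M.X ≅ (endoPow D.S n).obj M.X := M.α g
  have hα : (a M).hom ≫ D.S.map α.hom = α.hom ≫ (endoPow D.S n).map (a M).hom ≫
      eqToHom (endoPow_obj_comm D.S n M.X) := comm M g.toAdd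
  change D.trace M.X (push (pull α.hom (ξ.mapExactFunctor (endoPow D.S n)))
    (α.inv ≫ (a M).hom)) = _
  -- The exchange rule turns the pull-back along `α` into `S α`. Commuting it past `a` cancels `α⁻¹`
  -- and leaves the trace of `Sⁿ` applied to `push ξ a`.
  rw [push_pull, D.trace_pull, push_push, Category.assoc, hα, Iso.inv_hom_id_assoc, ← push_push,
    ← map_push, h.trace_endoPow]

end SerreEquiv

end

theorem corollary3p8 {k : Type w} [Field k] {A : Type u} [Category.{v} A] [Abelian A] [Linear k A]
    [∀ X Y : A, FiniteDimensional k (X ⟶ Y)]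
    (D : SerreEquiv.SerreDuality k A) (hperf : D.IsPerfect)
    (d : ℕ) [NeZero d] (hord : SerreEquiv.HasOrder D.S d) (hd : IsUnit (d : k)) :
    ∀ η : SerreEquiv.endoPow D.S d ≅ 𝟭 A, ∃ hη : SerreEquiv.IsCompatible η,
      Nonempty (SerreEquiv.SerreDuality k (SerreEquiv.CyclicEquivariantization k η hη)) ∧
      ∀ E : SerreEquiv.SerreDuality k (SerreEquiv.CyclicEquivariantization k η hη),
        Nonempty (E.S ≅ 𝟭 (SerreEquiv.CyclicEquivariantization k η hη)) := by
  intro η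
  have hη := hperf.isCompatible η
  obtain ⟨E₀, hE₀⟩ := hperf.exists_equivariantDuality hd.ne_zero η hη
  exact ⟨hη, ⟨E₀⟩, fun E => ⟨E.comparisonIso E₀ ≪≫ eqToIso hE₀⟩⟩
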